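/- **Ruin probability for the $\ast_\alpha$ random walk.** Let $\alpha,\beta,\gamma,\lambda>0$. Let $(U_k)_{k\ge1}$, $(V_k)_{k\ge1}$, $(T_k)_{k\ge1}$ be sequences of random variables, all mutually independent, such that: the claims $U_k\ge 0$ are identically distributed with $\mu_\alpha:=\mathbf E\,U_1^\alpha<\infty$; the premiums $V_k$ have cumulative distribution function $1-e^{-\gamma x^\alpha}$, $x>0$; the waiting times $T_k$ are exponential with mean $1/\lambda$. Assume the safety condition $\gamma\mu_\alpha\le\beta^\alpha$. Aggregate claims and premiums by the stable convolution $\ast_\alpha$: $X_0=Y_0=0$, $X_n=(X_{n-1}^\alpha+U_n^\alpha)^{1/\alpha}$, $Y_n=(Y_{n-1}^\alpha+V_n^\alpha)^{1/\alpha}$ for $n\ge1$. Let $S_n=T_1+\dots+T_n$ and $N_t=\sup\{n\ge1: S_n<t\}$ (with $\sup\emptyset=0$), and for an initial capital $u>0$ let $$R_t=\Bigl[u^\alpha+\beta^\alpha\sum_{n\ge1}Y_n^\alpha\mathbf 1_{\{N_t=n\}}\Bigr]^{1/\alpha}-\Bigl[\sum_{n\ge1}X_n^\alpha\mathbf 1_{\{N_t=n\}}\Bigr]^{1/\alpha},\qquad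 Q_\infty(u)=\mathbf P\{\exists\,t>0:\ R_t\le0\}.$$ Let $F$ be the cumulative distribution function of $U_1^\alpha$, let $G=1-F$, let $\widehat f(s)=\int_0^\infty e^{-zs}f(z)\,dz$, and let $$\delta(z)=\mathbf P\Bigl\{\sup_{n\ge1}\sum_{i=1}^n\bigl(U_i^\alpha-\beta^\alpha V_i^\alpha\bigr)<z\Bigr\}.$$ Then: 1. $Q_\infty(u)=1-\delta(u^\alpha)$ for every $u>0$. 2. $\mu_\alpha=\int_0^\infty(1-F(x))\,dx$, and for every $z\ge0$, $$\delta(z)=1-\frac{\gamma}{\beta^\alpha}\mu_\alpha+\frac{\gamma}{\beta^\alpha}\int_0^z\delta(z-x)\,(1-F(x))\,dx .$$ 3. For every $s>0$, $\widehat\delta(s)$ and $\widehat G(s)$ converge, $\beta^\alpha-\gamma\widehat G(s)>0$, and $$\widehat\delta(s)=\frac{\beta^\alpha-\gamma\mu_\alpha}{(\beta^\alpha-\gamma\widehat G(s))\,s}.\qquad(\ast)$$ 4. $\delta$ is continuous on $[0,\infty)$, and it is the only function continuous on $[0,\infty)$ whose Laplace transform converges and is given by $(\ast)$ for all $s>0$.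 -/

import Mathlib

noncomputable section

namespace StableRisk

open MeasureTheory ProbabilityTheory

variable {Ω : Type*}

/-- The addition underlying the stable convolution: `δ_a ∗_α δ_b = δ_c` with
`c = (a^α + b^α)^(1/α)`. -/
def stableAdd (α a b : ℝ) : ℝ := (a ^ α + b ^ α) ^ (1 / α)

/-- The random walk with respect to `∗_α`: `X_0 = 0`, `X_{n+1} = (X_n^α + W_{n+1}^α)^(1/α)`.
Sequences of steps are indexed from zero, so that `W n` is the `(n+1)`-st step. -/
def stableWalk (α : ℝ) (W : ℕ → Ω → ℝ) : ℕ → Ω → ℝ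
  | 0, _ => 0
  | n + 1, ω => stableAdd α (stableWalk α W n ω) (W n ω)

/-- The time `S_n = T_1 + ⋯ + T_n` of the `n`-th claim (`T k` is the `(k+1)`-st waiting time). -/
def claimTime (T : ℕ → Ω → ℝ) (n : ℕ) (ω : Ω) : ℝ := ∑ k ∈ Finset.range n, T k ω

/-- The claim arrival process `N_t = sup {n ≥ 1 : S_n < t}` (zero if there is no such `n`). -/
def claimCount (T : ℕ → Ω → ℝ) (t : ℝ) (ω : Ω) : ℕ :=
  sSup {n : ℕ | 1 ≤ n ∧ claimTime T n ω < t}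

open Classical in
/-- The risk process
`R_t = [u^α + β^α ∑_{n ≥ 1} Y_n^α 1{N_t = n}]^(1/α) - [∑_{n ≥ 1} X_n^α 1{N_t = n}]^(1/α)`,
where `X` and `Y` are the `∗_α` random walks with steps `U` and `V`. -/
def riskProcess (α β u : ℝ) (U V T : ℕ → Ω → ℝ) (t : ℝ) (ω : Ω) : ℝ :=
  (u ^ α + β ^ α *
      ∑' n : ℕ, if claimCount T t ω = n + 1 then stableWalk α V (n + 1) ω ^ α else 0) ^ (1 / α)
    - (∑' n : ℕ, if claimCount T t ω = n + 1 then stableWalk α U (n + 1) ω ^ α else 0) ^ (1 / α)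

/-- The event that ruin occurs at some time `t > 0`. -/
def ruinEvent (α β u : ℝ) (U V T : ℕ → Ω → ℝ) : Set Ω :=
  {ω | ∃ t : ℝ, 0 < t ∧ riskProcess α β u U V T t ω ≤ 0}

variable [MeasurableSpace Ω]

/-- The ruin probability `Q_∞(u)` in infinite time. -/
def ruinProb (P : Measure Ω) (α β u : ℝ) (U V T : ℕ → Ω → ℝ) : ℝ :=
  P.real (ruinEvent α β u U V T)

/-- `δ(z) = P{ sup_{n ≥ 1} ∑_{i=1}^n (U_i^α - β^α V_i^α) < z }`; the supremum is taken in the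
extended reals. -/
def survival (P : Measure Ω) (α β : ℝ) (U V : ℕ → Ω → ℝ) (z : ℝ) : ℝ :=
  P.real {ω | (⨆ n : ℕ,
    ((∑ i ∈ Finset.range (n + 1), (U i ω ^ α - β ^ α * V i ω ^ α) : ℝ) : EReal)) < (z : EReal)}

/-- The cumulative distribution function `F` of `U^α`, for one claim `U`. -/
def claimCDF (P : Measure Ω) (α : ℝ) (U : Ω → ℝ) (x : ℝ) : ℝ :=
  cdf (P.map fun ω => U ω ^ α) x

/-- The Laplace transform `f̂(s) = ∫_0^∞ e^{-zs} f(z) dz`. -/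
def laplace (f : ℝ → ℝ) (s : ℝ) : ℝ :=
  ∫ z in Set.Ioi (0 : ℝ), Real.exp (-(z * s)) * f z

/-- Convergence of the integral that defines the Laplace transform of `f` at `s`. -/
def LaplaceConverges (f : ℝ → ℝ) (s : ℝ) : Prop :=
  IntegrableOn (fun z => Real.exp (-(z * s)) * f z) (Set.Ioi (0 : ℝ))

end StableRisk

end

noncomputable section

namespace StableRisk

open MeasureTheory ProbabilityTheory Filter Topology Set

/-! Taking `α`-th powers turns `∗_α` into ordinary addition. With `A i = U i ^ α` and `W i = β ^ α *
V i ^ α` the steps `W i` are exponential with parameter `θ = γ / β ^ α` (`map_premium`), and ruin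
happens exactly when a partial sum of `A i - W i` reaches `u ^ α` (`mem_ruinEvent_iff`). What
remains is the classical Cramér–Lundberg problem.

Let `φ = staysBelow`. Conditioning on the first step gives `φ z = E φ (z - A + W)` for `z ≥ 0`
(`measureReal_walk_le_eq_integral`). Since `W` is exponential, the right side `ψ` is continuous and
satisfies `ψ' = θ (ψ - H)` off a countable set, where `H z = E φ (z - A)`. As `φ` vanishes on the
negative axis, `∫ H` over `[0, z]` is the convolution of `φ` with `F`; integrating the equation
gives the renewal equation with unknown constant `φ 0` (`renewal_of_eq_stepMean`).

Letting `z → ∞`, the limit `p` of `φ` satisfies `p = φ 0 + θ m p`. If `θ m < 1`, the strong law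
gives `p = 1`; if `θ m = 1`, then `φ 0 = 0` whatever `p` is. Either way `φ 0 = 1 - θ m`
(`staysBelow_zero`). The Laplace transform turns the convolution into a product, and uniqueness is
Lerch's theorem, by Weierstrass approximation in `x = exp (-z)`. Continuity of `ψ` makes strict and
weak inequalities interchangeable, so `δ = ψ`. -/

/-! ### Averaging over one step, and the renewal equation -/

lemma integral_expMeasure {θ : ℝ} (hθ : 0 < θ) (f : ℝ → ℝ) :
    ∫ w, f w ∂expMeasure θ = ∫ w in Ioi (0 : ℝ), θ * Real.exp (-(θ * w)) * f w := by
  have h1 : expMeasure θ = volume.withDensity (exponentialPDF θ) := rfl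
  rw [h1, integral_withDensity_eq_integral_toReal_smul₀
    (by unfold exponentialPDF; fun_prop) (Eventually.of_forall fun x => by simp [exponentialPDF]),
    ← integral_indicator measurableSet_Ioi]
  refine integral_congr_ae ?_
  filter_upwards [compl_mem_ae_iff.2 (measure_singleton (0 : ℝ))] with w hw
  have hw0 : w ≠ 0 := hw
  rcases lt_or_gt_of_ne hw0 with h | h
  · simp [exponentialPDF_of_neg h, not_lt.2 h.le]
  · have hp : 0 ≤ θ * Real.exp (-(θ * w)) := by positivity
    simp [exponentialPDF_of_nonneg h.le, h, ENNReal.toReal_ofReal hp]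

lemma integrable_of_measurable_of_mem_Icc {E : Type*} [MeasurableSpace E] {ρ : Measure E}
    [IsFiniteMeasure ρ] {f : E → ℝ} (hf : Measurable f) (h0 : ∀ x, 0 ≤ f x) (h1 : ∀ x, f x ≤ 1) :
    Integrable f ρ :=
  Integrable.of_bound hf.aestronglyMeasurable 1
    (Eventually.of_forall fun x => by rw [Real.norm_eq_abs, abs_of_nonneg (h0 x)]; exact h1 x)

/-- The mean of `φ (v - a)` for `a` distributed according to `μ`. -/
def claimMean (μ : Measure ℝ) (φ : ℝ → ℝ) (v : ℝ) : ℝ := ∫ a, φ (v - a) ∂μ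

/-- The mean of `φ (z - a + w)` for independent `a`, `w`, where `a` is distributed according to `μ`
and `w` is exponential with parameter `θ`. -/
def stepMean (μ : Measure ℝ) (θ : ℝ) (φ : ℝ → ℝ) (z : ℝ) : ℝ :=
  ∫ a, ∫ w, φ (z - a + w) ∂expMeasure θ ∂μ

section

variable {μ : Measure ℝ} [IsProbabilityMeasure μ] {θ : ℝ} {φ : ℝ → ℝ}

lemma claimMean_monotone (hm : Monotone φ) (h0 : ∀ x, 0 ≤ φ x) (h1 : ∀ x, φ x ≤ 1) :
    Monotone (claimMean μ φ) := by
  intro v w hvw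
  have hφ := hm.measurable
  exact integral_mono
    (integrable_of_measurable_of_mem_Icc (by fun_prop) (fun _ => h0 _) (fun _ => h1 _))
    (integrable_of_measurable_of_mem_Icc (by fun_prop) (fun _ => h0 _) (fun _ => h1 _))
    (fun a => hm (by linarith))

omit [IsProbabilityMeasure μ] in
lemma claimMean_nonneg (h0 : ∀ x, 0 ≤ φ x) (v : ℝ) : 0 ≤ claimMean μ φ v :=
  integral_nonneg fun _ => h0 _

lemma claimMean_le_one (hm : Monotone φ) (h0 : ∀ x, 0 ≤ φ x) (h1 : ∀ x, φ x ≤ 1) (v : ℝ) :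
    claimMean μ φ v ≤ 1 := by
  have hφ := hm.measurable
  have := integral_mono (μ := μ) (f := fun a => φ (v - a)) (g := fun _ => (1 : ℝ))
    (integrable_of_measurable_of_mem_Icc (by fun_prop) (fun _ => h0 _) (fun _ => h1 _))
    (integrable_const _) (fun a => h1 _)
  simpa [claimMean] using this

/-- The integrand in `stepMean_eq_exp_mul_integral`. -/
def stepKernel (μ : Measure ℝ) (θ : ℝ) (φ : ℝ → ℝ) (v : ℝ) : ℝ :=
  θ * Real.exp (-(θ * v)) * claimMean μ φ v

lemma integrableOn_stepKernel (hθ : 0 < θ) (hm : Monotone φ) (h0 : ∀ x, 0 ≤ φ x)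
    (h1 : ∀ x, φ x ≤ 1) (z : ℝ) : IntegrableOn (stepKernel μ θ φ) (Ioi z) := by
  have hexp : IntegrableOn (fun v => θ * Real.exp (-(θ * v))) (Ioi z) := by
    simp only [neg_mul_eq_neg_mul]
    exact (exp_neg_integrableOn_Ioi z hθ).const_mul θ
  refine hexp.mul_bdd (c := 1) (claimMean_monotone hm h0 h1).measurable.aestronglyMeasurable ?_
  refine Eventually.of_forall fun v => ?_
  rw [Real.norm_eq_abs, abs_of_nonneg (claimMean_nonneg h0 v)]
  exact claimMean_le_one hm h0 h1 v

/-- After Fubini, the shift `v = z + w` moves `z` out of `φ` into an exponential factor and a limit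
of integration; hence `stepMean` is continuous even though `φ` may jump. -/
lemma stepMean_eq_exp_mul_integral (hθ : 0 < θ) (hm : Monotone φ) (h0 : ∀ x, 0 ≤ φ x)
    (h1 : ∀ x, φ x ≤ 1) (z : ℝ) :
    stepMean μ θ φ z = Real.exp (θ * z) * ∫ v in Ioi z, stepKernel μ θ φ v := by
  have := isProbabilityMeasure_expMeasure hθ
  have hφ := hm.measurable
  have hswap : stepMean μ θ φ z = ∫ w, claimMean μ φ (z + w) ∂expMeasure θ := by
    unfold stepMean claimMean
    rw [integral_integral_swap (f := fun a w => φ (z - a + w))]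
    · refine integral_congr_ae (Eventually.of_forall fun w => ?_)
      refine integral_congr_ae (Eventually.of_forall fun a => ?_)
      simp only
      congr 1
      ring
    · exact integrable_of_measurable_of_mem_Icc (by unfold Function.uncurry; fun_prop)
        (fun _ => h0 _) (fun _ => h1 _)
  rw [hswap, integral_expMeasure hθ, ← integral_const_mul, ← integral_indicator measurableSet_Ioi,
    ← integral_indicator measurableSet_Ioi,
    ← integral_add_left_eq_self (μ := volume) ((Ioi z).indicator _) z]
  refine integral_congr_ae (Eventually.of_forall fun w => ?_)
  simp only [indicator_apply, mem_Ioi, lt_add_iff_pos_right, stepKernel]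
  split_ifs
  · have : Real.exp (-(θ * w)) = Real.exp (θ * z) * Real.exp (-(θ * (z + w))) := by
      rw [← Real.exp_add]; ring_nf
    rw [this]; ring
  · rfl

lemma stepMean_eq_exp_mul_sub (hθ : 0 < θ) (hm : Monotone φ) (h0 : ∀ x, 0 ≤ φ x)
    (h1 : ∀ x, φ x ≤ 1) (z : ℝ) :
    stepMean μ θ φ z = Real.exp (θ * z) *
      ((∫ v in Ioi 0, stepKernel μ θ φ v) - ∫ v in (0 : ℝ)..z, stepKernel μ θ φ v) := by
  rw [stepMean_eq_exp_mul_integral hθ hm h0 h1, ← intervalIntegral.integral_Ioi_sub_Ioi'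
    (integrableOn_stepKernel hθ hm h0 h1 0) (integrableOn_stepKernel hθ hm h0 h1 z), sub_sub_cancel]

lemma intervalIntegrable_stepKernel (hθ : 0 < θ) (hm : Monotone φ) (h0 : ∀ x, 0 ≤ φ x)
    (h1 : ∀ x, φ x ≤ 1) (a b : ℝ) : IntervalIntegrable (stepKernel μ θ φ) volume a b :=
  ⟨(integrableOn_stepKernel hθ hm h0 h1 a).mono_set Ioc_subset_Ioi_self,
    (integrableOn_stepKernel hθ hm h0 h1 b).mono_set Ioc_subset_Ioi_self⟩

lemma continuous_stepMean (hθ : 0 < θ) (hm : Monotone φ) (h0 : ∀ x, 0 ≤ φ x)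
    (h1 : ∀ x, φ x ≤ 1) : Continuous (stepMean μ θ φ) := by
  have := intervalIntegral.continuous_primitive
    (intervalIntegrable_stepKernel (μ := μ) hθ hm h0 h1) 0
  rw [funext (stepMean_eq_exp_mul_sub (μ := μ) hθ hm h0 h1)]
  fun_prop

/-- Integrated form of `ψ' = θ (ψ - H)` with `H = claimMean μ φ`. The derivative exists wherever `H`
is continuous; `H` is monotone, so the exceptions are countable. -/
lemma stepMean_sub_stepMean_zero (hθ : 0 < θ) (hm : Monotone φ) (h0 : ∀ x, 0 ≤ φ x)
    (h1 : ∀ x, φ x ≤ 1) (z : ℝ) :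
    stepMean μ θ φ z - stepMean μ θ φ 0 =
      θ * ((∫ y in (0 : ℝ)..z, stepMean μ θ φ y) - ∫ y in (0 : ℝ)..z, claimMean μ φ y) := by
  have hcont := continuous_stepMean (μ := μ) hθ hm h0 h1
  have hHm := claimMean_monotone (μ := μ) hm h0 h1
  have hki := intervalIntegrable_stepKernel (μ := μ) hθ hm h0 h1
  rw [← intervalIntegral.integral_sub (hcont.intervalIntegrable _ _) hHm.intervalIntegrable,
    ← intervalIntegral.integral_const_mul]
  symm
  refine MeasureTheory.integral_eq_of_hasDerivAt_off_countable (stepMean μ θ φ) _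
    hHm.countable_not_continuousAt hcont.continuousOn ?_
    (((hcont.intervalIntegrable _ _).sub hHm.intervalIntegrable).const_mul _)
  intro x hx
  have hHx : ContinuousAt (claimMean μ φ) x := by simpa using hx.2
  have hkx : ContinuousAt (stepKernel μ θ φ) x := by unfold stepKernel; fun_prop
  have hkm : StronglyMeasurableAtFilter (stepKernel μ θ φ) (𝓝 x) volume :=
    (Measurable.stronglyMeasurable (by unfold stepKernel; have := hHm.measurable; fun_prop)
      ).stronglyMeasurableAtFilter
  have hd := intervalIntegral.integral_hasDerivAt_right (hki 0 x) hkm hkx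
  have he : HasDerivAt (fun y => Real.exp (θ * y)) (Real.exp (θ * x) * θ) x := by
    simpa using ((hasDerivAt_id x).const_mul θ).exp
  have := he.mul (hd.const_sub (∫ v in Ioi 0, stepKernel μ θ φ v))
  rw [funext (stepMean_eq_exp_mul_sub (μ := μ) hθ hm h0 h1)]
  convert! this using 1
  have hee : Real.exp (θ * x) * Real.exp (-(θ * x)) = 1 := by rw [← Real.exp_add]; simp
  simp only [stepKernel]
  linear_combination (θ * claimMean μ φ x) * hee

lemma integral_claimMean (hm : Monotone φ) (h0 : ∀ x, 0 ≤ φ x) (h1 : ∀ x, φ x ≤ 1)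
    (hneg : ∀ x < 0, φ x = 0) (hμ : ∀ᵐ a ∂μ, 0 ≤ a) {z : ℝ} (hz : 0 ≤ z) :
    ∫ y in (0 : ℝ)..z, claimMean μ φ y = ∫ x in (0 : ℝ)..z, φ (z - x) * μ.real (Iic x) := by
  have hφ := hm.measurable
  have hF : ∀ x, φ (z - x) * μ.real (Iic x) = ∫ a, (if a ≤ x then φ (z - x) else 0) ∂μ := by
    intro x
    have : (fun a => if a ≤ x then φ (z - x) else 0) = (Iic x).indicator fun _ => φ (z - x) := by
      ext a; simp [indicator_apply]
    rw [this, integral_indicator_const _ measurableSet_Iic, smul_eq_mul, mul_comm]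
  simp_rw [hF]
  rw [intervalIntegral.integral_of_le hz, intervalIntegral.integral_of_le hz]
  unfold claimMean
  rw [integral_integral_swap (f := fun y a => φ (y - a)), integral_integral_swap
    (f := fun x a => if a ≤ x then φ (z - x) else 0)]
  · refine integral_congr_ae ?_
    filter_upwards [hμ] with a ha
    -- Reflection `x ↦ z + a - x` for fixed `a`; closed intervals are used because it swaps
    -- endpoints. The range becomes `[a, z + a]`, and the part beyond `z` contributes nothing
    -- because `φ` vanishes there.
    rw [← integral_Icc_eq_integral_Ioc, ← integral_Icc_eq_integral_Ioc,
      ← integral_indicator measurableSet_Icc, ← integral_indicator measurableSet_Icc,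
      ← integral_sub_left_eq_self _ volume (z + a)]
    refine integral_congr_ae (Eventually.of_forall fun x => ?_)
    have hx : z + a - x - a = z - x := by ring
    simp only [indicator_apply, mem_Icc, hx]
    rcases lt_or_ge (z - x) 0 with h | h
    · simp [hneg _ h]
    · by_cases hax : a ≤ x
      · rw [if_pos ⟨by linarith, by linarith⟩, if_pos ⟨by linarith, by linarith⟩, if_pos hax]
      · rw [if_neg (fun h => hax (by linarith [h.2])), if_neg hax, ite_self]
  · refine integrable_of_measurable_of_mem_Icc ?_ (fun p => ?_) (fun p => ?_)
    · exact Measurable.ite (measurableSet_le measurable_snd measurable_fst) (by fun_prop)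
        measurable_const
    · simp only [Function.uncurry]; split_ifs <;> simp [h0]
    · simp only [Function.uncurry]; split_ifs <;> simp [h1]
  · exact integrable_of_measurable_of_mem_Icc (by unfold Function.uncurry; fun_prop)
        (fun _ => h0 _) (fun _ => h1 _)

lemma antitone_tail (μ : Measure ℝ) [IsProbabilityMeasure μ] :
    Antitone fun x => 1 - μ.real (Iic x) :=
  fun _ _ hxy => sub_le_sub_left (measureReal_mono (Iic_subset_Iic.2 hxy)) 1

lemma tail_nonneg (μ : Measure ℝ) [IsProbabilityMeasure μ] (x : ℝ) : 0 ≤ 1 - μ.real (Iic x) :=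
  sub_nonneg.2 measureReal_le_one

lemma intervalIntegrable_mul_tail (hm : Monotone φ) (h0 : ∀ x, 0 ≤ φ x)
    (z a b : ℝ) :
    IntervalIntegrable (fun x => φ (z - x) * (1 - μ.real (Iic x))) volume a b := by
  refine Antitone.intervalIntegrable fun x y hxy => ?_
  exact mul_le_mul (hm (by linarith)) (antitone_tail μ hxy) (tail_nonneg μ y) (h0 _)

/-- The renewal equation for a bounded monotone `φ` with `φ = stepMean μ θ φ` on `[0, ∞)`. -/
lemma renewal_of_eq_stepMean (hθ : 0 < θ) (hm : Monotone φ) (h0 : ∀ x, 0 ≤ φ x)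
    (h1 : ∀ x, φ x ≤ 1) (hneg : ∀ x < 0, φ x = 0) (hμ : ∀ᵐ a ∂μ, 0 ≤ a)
    (hfix : ∀ z, 0 ≤ z → φ z = stepMean μ θ φ z) {z : ℝ} (hz : 0 ≤ z) :
    φ z = φ 0 + θ * ∫ x in (0 : ℝ)..z, φ (z - x) * (1 - μ.real (Iic x)) := by
  have key := stepMean_sub_stepMean_zero (μ := μ) hθ hm h0 h1 z
  rw [← hfix z hz, ← hfix 0 le_rfl, integral_claimMean hm h0 h1 hneg hμ hz] at key
  have e1 : ∫ y in (0 : ℝ)..z, stepMean μ θ φ y = ∫ x in (0 : ℝ)..z, φ (z - x) := by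
    rw [intervalIntegral.integral_comp_sub_left (fun y => φ y) z]
    simp only [sub_self, sub_zero]
    refine intervalIntegral.integral_congr fun y hy => ?_
    rw [uIcc_of_le hz] at hy
    exact (hfix y hy.1).symm
  have hφ : IntervalIntegrable (fun x => φ (z - x)) volume 0 z :=
    Antitone.intervalIntegrable fun x y hxy => hm (by linarith)
  have hφG := intervalIntegrable_mul_tail (μ := μ) hm h0 z 0 z
  have hφF : IntervalIntegrable (fun x => φ (z - x) * μ.real (Iic x)) volume 0 z := by
    refine (hφ.sub hφG).congr fun x _ => ?_
    ring
  rw [e1, ← intervalIntegral.integral_sub hφ hφF] at key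
  rw [← sub_eq_iff_eq_add', key]
  congr 1
  refine intervalIntegral.integral_congr fun x _ => ?_
  ring

end

/-! ### Tail integrals, and the Laplace transform of the renewal equation -/

section

variable {μ : Measure ℝ} [IsProbabilityMeasure μ] {θ : ℝ} {φ : ℝ → ℝ}

lemma tail_eq (μ : Measure ℝ) [IsProbabilityMeasure μ] (x : ℝ) :
    1 - μ.real (Iic x) = μ.real {a | x < a} := by
  rw [← probReal_compl_eq_one_sub measurableSet_Iic, compl_Iic]
  rfl

lemma integral_tail (hμ : ∀ᵐ a ∂μ, 0 ≤ a) (hint : Integrable (fun a => a) μ) :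
    ∫ x in Ioi (0 : ℝ), (1 - μ.real (Iic x)) = ∫ a, a ∂μ := by
  simp_rw [tail_eq]
  exact (hint.integral_eq_integral_meas_lt hμ).symm

lemma integrableOn_tail (hμ : ∀ᵐ a ∂μ, 0 ≤ a) (hint : Integrable (fun a => a) μ) :
    IntegrableOn (fun x => 1 - μ.real (Iic x)) (Ioi 0) := by
  refine ⟨(antitone_tail μ).measurable.aestronglyMeasurable, ?_⟩
  rw [hasFiniteIntegral_iff_ofReal (Eventually.of_forall (tail_nonneg μ))]
  have h := lintegral_eq_lintegral_meas_lt μ hμ hint.aemeasurable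
  simp only [tail_eq]
  rw [lintegral_congr fun x => ofReal_measureReal, ← h]
  exact hint.lintegral_lt_top

/-- Since `φ` vanishes on the negative axis, the upper limit `z` may be replaced by `∞`; the
integrable tail then dominates. -/
lemma tendsto_integral_mul_tail (hm : Monotone φ) (h0 : ∀ x, 0 ≤ φ x) (h1 : ∀ x, φ x ≤ 1)
    (hneg : ∀ x < 0, φ x = 0) (hμ : ∀ᵐ a ∂μ, 0 ≤ a) (hint : Integrable (fun a => a) μ)
    {p : ℝ} (hp : Tendsto φ atTop (𝓝 p)) :
    Tendsto (fun z => ∫ x in (0 : ℝ)..z, φ (z - x) * (1 - μ.real (Iic x))) atTop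
      (𝓝 (p * ∫ a, a ∂μ)) := by
  have hG := (antitone_tail μ).measurable
  have hφ := hm.measurable
  have hlim : Tendsto (fun z => ∫ x in Ioi (0 : ℝ), φ (z - x) * (1 - μ.real (Iic x))) atTop
      (𝓝 (∫ x in Ioi (0 : ℝ), p * (1 - μ.real (Iic x)))) := by
    refine tendsto_integral_filter_of_dominated_convergence (fun x => 1 - μ.real (Iic x))
      (Eventually.of_forall fun z => Measurable.aestronglyMeasurable (by fun_prop))
      (Eventually.of_forall fun z => Eventually.of_forall fun x => ?_)
      (integrableOn_tail hμ hint) (Eventually.of_forall fun x => ?_)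
    · rw [Real.norm_eq_abs, abs_of_nonneg (mul_nonneg (h0 _) (tail_nonneg μ x))]
      exact mul_le_of_le_one_left (tail_nonneg μ x) (h1 _)
    · refine Tendsto.mul_const _ (hp.comp ?_)
      exact tendsto_atTop_add_const_right _ (-x) tendsto_id
  rw [integral_const_mul, integral_tail hμ hint] at hlim
  refine hlim.congr' ?_
  filter_upwards [eventually_ge_atTop 0] with z hz
  rw [intervalIntegral.integral_of_le hz]
  refine setIntegral_eq_of_subset_of_forall_sdiff_eq_zero measurableSet_Ioi Ioc_subset_Ioi_self ?_
  intro x hx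
  have hzx : z < x := by
    by_contra h
    exact hx.2 ⟨hx.1, not_lt.1 h⟩
  rw [hneg _ (by linarith), zero_mul]

lemma laplaceConverges_of_bounded {f : ℝ → ℝ} (hf : Measurable f) (h0 : ∀ x, 0 ≤ f x)
    (h1 : ∀ x, f x ≤ 1) {s : ℝ} (hs : 0 < s) : LaplaceConverges f s := by
  have hexp : IntegrableOn (fun z => Real.exp (-(z * s))) (Ioi 0) := by
    simp only [mul_comm _ s, neg_mul_eq_neg_mul]
    exact exp_neg_integrableOn_Ioi 0 hs
  refine hexp.mul_bdd (c := 1) hf.aestronglyMeasurable (Eventually.of_forall fun v => ?_)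
  rw [Real.norm_eq_abs, abs_of_nonneg (h0 v)]
  exact h1 v

lemma laplace_one {s : ℝ} (hs : 0 < s) : ∫ z in Ioi (0 : ℝ), Real.exp (-(z * s)) = 1 / s := by
  have h := integral_exp_mul_Ioi (neg_neg_iff_pos.2 hs) 0
  simp only [mul_zero, Real.exp_zero] at h
  simp only [mul_comm _ s, neg_mul_eq_neg_mul, h]
  field_simp

/-- The transform is at most the mean, which suffices unless the two are equal. Equality forces the
tail to vanish almost everywhere, because `exp (-(x * s)) < 1`; then the transform is `0`. -/
lemma mul_laplace_tail_lt (hθ : 0 < θ) (hμ : ∀ᵐ a ∂μ, 0 ≤ a) (hint : Integrable (fun a => a) μ)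
    (hsafe : θ * ∫ a, a ∂μ ≤ 1) {s : ℝ} (hs : 0 < s) :
    θ * laplace (fun x => 1 - μ.real (Iic x)) s < 1 := by
  have hG := integrableOn_tail hμ hint
  have hL : LaplaceConverges (fun x => 1 - μ.real (Iic x)) s :=
    laplaceConverges_of_bounded (antitone_tail μ).measurable (tail_nonneg μ)
      (fun x => by linarith [measureReal_nonneg (μ := μ) (s := Iic x)]) hs
  have hpt : ∀ x ∈ Ioi (0 : ℝ), Real.exp (-(x * s)) * (1 - μ.real (Iic x)) ≤
      1 - μ.real (Iic x) := fun x hx => by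
    refine mul_le_of_le_one_left (tail_nonneg μ x) (Real.exp_le_one_iff.2 ?_)
    have : 0 < x * s := mul_pos hx hs
    linarith
  have hle : laplace (fun x => 1 - μ.real (Iic x)) s ≤ ∫ a, a ∂μ := by
    rw [← integral_tail hμ hint]
    exact setIntegral_mono_on hL hG measurableSet_Ioi hpt
  rcases hle.lt_or_eq with h | h
  · exact (mul_lt_mul_of_pos_left h hθ).trans_le hsafe
  · have hae : (fun x => (1 - μ.real (Iic x)) - Real.exp (-(x * s)) * (1 - μ.real (Iic x)))
        =ᵐ[volume.restrict (Ioi 0)] 0 := by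
      refine (integral_eq_zero_iff_of_nonneg_ae ?_ (hG.sub hL)).1 ?_
      rotate_left
      · refine (integral_sub hG hL).trans ?_
        rw [integral_tail hμ hint, ← h]
        exact sub_self _
      · filter_upwards [ae_restrict_mem measurableSet_Ioi] with x hx
        exact sub_nonneg.2 (hpt x hx)
    have hzero : (fun x => Real.exp (-(x * s)) * (1 - μ.real (Iic x)))
        =ᵐ[volume.restrict (Ioi 0)] 0 := by
      filter_upwards [hae, ae_restrict_mem measurableSet_Ioi] with x hx hx0
      have h2 : (1 - μ.real (Iic x)) * (1 - Real.exp (-(x * s))) = 0 := by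
        simp only [Pi.zero_apply] at hx; linarith
      have h3 : Real.exp (-(x * s)) < 1 :=
        Real.exp_lt_one_iff.2 (by have : 0 < x * s := mul_pos hx0 hs; linarith)
      rcases mul_eq_zero.1 h2 with h4 | h4
      · simp [h4]
      · linarith
    unfold laplace
    rw [integral_congr_ae hzero]
    simp

lemma laplace_of_renewal (hm : Monotone φ) (h0 : ∀ x, 0 ≤ φ x) (h1 : ∀ x, φ x ≤ 1)
    (hren : ∀ z, 0 ≤ z → φ z = φ 0 + θ * ∫ x in (0 : ℝ)..z, φ (z - x) * (1 - μ.real (Iic x)))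
    {s : ℝ} (hs : 0 < s) :
    laplace φ s = φ 0 / s + θ * laplace (fun x => 1 - μ.real (Iic x)) s * laplace φ s := by
  have hφL := laplaceConverges_of_bounded hm.measurable h0 h1 hs
  have hGL : LaplaceConverges (fun x => 1 - μ.real (Iic x)) s :=
    laplaceConverges_of_bounded (antitone_tail μ).measurable (tail_nonneg μ)
      (fun x => by linarith [measureReal_nonneg (μ := μ) (s := Iic x)]) hs
  have hexp : IntegrableOn (fun z => Real.exp (-(z * s)) * φ 0) (Ioi 0) := by
    exact laplaceConverges_of_bounded (f := fun _ => φ 0) measurable_const (fun _ => h0 _)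
      (fun _ => h1 _) hs
  have hconv := integral_posConvolution (μ := volume) (ν := volume) hGL hφL
    (ContinuousLinearMap.mul ℝ ℝ)
  have hconv' := integrable_posConvolution (μ := volume) (ν := volume) hGL hφL
    (ContinuousLinearMap.mul ℝ ℝ)
  -- The weight is multiplicative along `z = t + (z - t)`, so convolving weighted functions weights
  -- the convolution.
  have hc : ∀ z, ∫ t in (0 : ℝ)..z, ContinuousLinearMap.mul ℝ ℝ
      (Real.exp (-(t * s)) * (1 - μ.real (Iic t))) (Real.exp (-((z - t) * s)) * φ (z - t)) =
      Real.exp (-(z * s)) * ∫ x in (0 : ℝ)..z, φ (z - x) * (1 - μ.real (Iic x)) := by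
    intro z
    rw [← intervalIntegral.integral_const_mul]
    refine intervalIntegral.integral_congr fun t _ => ?_
    have : Real.exp (-(z * s)) = Real.exp (-(t * s)) * Real.exp (-((z - t) * s)) := by
      rw [← Real.exp_add]; ring_nf
    simp only [ContinuousLinearMap.mul_apply', this]
    ring
  unfold posConvolution at hconv'
  rw [integrable_indicator_iff measurableSet_Ioi] at hconv'
  simp_rw [hc] at hconv hconv'
  have hsplit : laplace φ s = ∫ z in Ioi (0 : ℝ), (Real.exp (-(z * s)) * φ 0 +
      θ * (Real.exp (-(z * s)) * ∫ x in (0 : ℝ)..z, φ (z - x) * (1 - μ.real (Iic x)))) := by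
    refine setIntegral_congr_fun measurableSet_Ioi fun z hz => ?_
    rw [hren z (le_of_lt hz)]
    ring
  rw [integral_add hexp (hconv'.const_mul θ), integral_mul_const, laplace_one hs,
    integral_const_mul, hconv] at hsplit
  refine hsplit.trans ?_
  simp only [ContinuousLinearMap.mul_apply', laplace]
  ring

end

/-! ### Injectivity of the Laplace transform -/

/-- A function on `(0, ∞)` is almost everywhere zero if its Laplace transform vanishes. -/
lemma ae_eq_zero_of_laplace_eq_zero {h : ℝ → ℝ} (hc : ∀ s, 0 < s → LaplaceConverges h s)
    (hz : ∀ s, 0 < s → laplace h s = 0) : ∀ᵐ x, x ∈ Ioi (0 : ℝ) → h x = 0 := by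
  have hk : IntegrableOn (fun z => Real.exp (-z) * h z) (Ioi 0) := by
    simpa [LaplaceConverges] using hc 1 one_pos
  -- The transform at `s = n + 1` is the `n`-th moment in the variable `exp (-z)`.
  have hpow : ∀ n : ℕ, ∫ z in Ioi (0 : ℝ), Real.exp (-z) ^ n * (Real.exp (-z) * h z) = 0 := by
    intro n
    refine Eq.trans ?_ (hz (n + 1) (by positivity))
    refine integral_congr_ae (Eventually.of_forall fun z => ?_)
    simp only
    rw [← mul_assoc, ← Real.exp_nat_mul, ← Real.exp_add]
    ring_nf
  have hbd : ∀ f : ℝ → ℝ, Continuous f →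
      IntegrableOn (fun z => f (Real.exp (-z)) * (Real.exp (-z) * h z)) (Ioi 0) := by
    intro f hf
    obtain ⟨C, hC⟩ := isCompact_Icc.exists_bound_of_continuousOn (hf.continuousOn (s := Icc 0 1))
    refine hk.bdd_mul (c := C) (by fun_prop) ?_
    filter_upwards [ae_restrict_mem measurableSet_Ioi] with z hz
    exact hC _ ⟨(Real.exp_pos _).le, Real.exp_le_one_iff.2 (by simpa using le_of_lt hz)⟩
  have hpoly : ∀ p : Polynomial ℝ,
      ∫ z in Ioi (0 : ℝ), p.eval (Real.exp (-z)) * (Real.exp (-z) * h z) = 0 := by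
    intro p
    induction p using Polynomial.induction_on' with
    | add p q hp hq =>
      simp only [Polynomial.eval_add, add_mul]
      rw [integral_add (hbd _ p.continuous) (hbd _ q.continuous), hp, hq, add_zero]
    | monomial n a =>
      simp only [Polynomial.eval_monomial, mul_assoc]
      rw [integral_const_mul, hpow, mul_zero]
  have hcont : ∀ f : ℝ → ℝ, Continuous f →
      ∫ z in Ioi (0 : ℝ), f (Real.exp (-z)) * (Real.exp (-z) * h z) = 0 := by
    intro f hf
    set I := ∫ z in Ioi (0 : ℝ), ‖Real.exp (-z) * h z‖ with hI
    have hI0 : 0 ≤ I := integral_nonneg fun _ => norm_nonneg _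
    rw [← norm_le_zero_iff]
    refine le_of_forall_pos_le_add fun ε hε => ?_
    -- Weierstrass on `[0, 1]`; the `+ 1` avoids division by zero when `I = 0`.
    obtain ⟨p, hp⟩ := exists_polynomial_near_of_continuousOn 0 1 f hf.continuousOn
      (ε / (I + 1)) (by positivity)
    have : ∫ z in Ioi (0 : ℝ), f (Real.exp (-z)) * (Real.exp (-z) * h z) =
        ∫ z in Ioi (0 : ℝ), (f (Real.exp (-z)) - p.eval (Real.exp (-z))) *
          (Real.exp (-z) * h z) := by
      simp only [sub_mul]
      rw [integral_sub (hbd _ hf) (hbd _ p.continuous), hpoly, sub_zero]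
    rw [this]
    calc _ ≤ ∫ z in Ioi (0 : ℝ), ε / (I + 1) * ‖Real.exp (-z) * h z‖ := by
          refine norm_integral_le_of_norm_le (hk.norm.const_mul _) ?_
          filter_upwards [ae_restrict_mem measurableSet_Ioi] with z hz
          rw [norm_mul]
          refine mul_le_mul_of_nonneg_right ?_ (norm_nonneg _)
          rw [norm_sub_rev]
          exact (hp _ ⟨(Real.exp_pos _).le,
            Real.exp_le_one_iff.2 (by simpa using le_of_lt hz)⟩).le
      _ = ε * (I / (I + 1)) := by rw [integral_const_mul, ← hI]; ring
      _ ≤ 0 + ε := by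
          rw [zero_add]
          exact mul_le_of_le_one_right hε.le (div_le_one_of_le₀ (by linarith) (by linarith))
  have hmain := IsOpen.ae_eq_zero_of_integral_contDiff_smul_eq_zero (isOpen_Ioi (a := (0 : ℝ)))
    (μ := volume) (f := fun z => Real.exp (-z) * h z) hk.locallyIntegrableOn ?_
  · filter_upwards [hmain] with x hx hx0
    exact (mul_eq_zero.1 (hx hx0)).resolve_left (Real.exp_pos _).ne'
  · intro g hg hgc hgs
    have hg0 : ∀ x, x ∉ Ioi (0 : ℝ) → g x = 0 := fun x hx => by
      by_contra hne
      exact hx (hgs (subset_tsupport g hne))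
    -- A test function `g` is a continuous function of `exp (-z)`. At `x = 0` compact support makes
    -- the composite vanish nearby, and the default `Real.log 0 = 0` gives the value `g 0 = 0`.
    have hf : Continuous fun x => g (-Real.log x) := by
      rw [continuous_iff_continuousAt]
      intro x
      rcases eq_or_ne x 0 with rfl | hx
      · have hev : ∀ᶠ x in 𝓝 (0 : ℝ), g (-Real.log x) = 0 := by
          have h1 := (Real.tendsto_log_nhdsNE_zero.const_mul_atBot_of_neg
            (neg_one_lt_zero (R := ℝ))).mono_right atTop_le_cocompact
          rw [← nhdsNE_sup_pure, eventually_sup]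
          refine ⟨?_, by simpa using hg0 0 (by simp)⟩
          rw [hasCompactSupport_iff_eventuallyEq, coclosedCompact_eq_cocompact] at hgc
          filter_upwards [h1.eventually hgc] with x hx
          simpa using hx
        exact (continuousAt_const (y := (0 : ℝ))).congr (hev.mono fun _ h => h.symm)
      · exact hg.continuous.continuousAt.comp (Real.continuousAt_log hx).neg
    have := hcont _ hf
    simp only [Real.log_exp, neg_neg] at this
    rw [← this, ← integral_indicator measurableSet_Ioi]
    refine integral_congr_ae (Eventually.of_forall fun x => ?_)
    by_cases hx : x ∈ Ioi (0 : ℝ)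
    · simp [indicator_of_mem hx]
    · simp [indicator_of_notMem hx, hg0 x hx]

lemma eqOn_Ici_of_laplace_eq {f g : ℝ → ℝ} (hf : ContinuousOn f (Ici 0))
    (hg : ContinuousOn g (Ici 0)) (hfc : ∀ s, 0 < s → LaplaceConverges f s)
    (hgc : ∀ s, 0 < s → LaplaceConverges g s)
    (hfg : ∀ s, 0 < s → laplace f s = laplace g s) : EqOn f g (Ici 0) := by
  have hae := ae_eq_zero_of_laplace_eq_zero (h := fun x => f x - g x)
    (fun s hs => by
      have := (hfc s hs).sub (hgc s hs)
      unfold LaplaceConverges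
      refine this.congr (Eventually.of_forall fun x => ?_)
      simp only [Pi.sub_apply]; ring)
    (fun s hs => by
      have := hfg s hs
      unfold laplace at this ⊢
      simp only [mul_sub]
      rw [integral_sub (hfc s hs) (hgc s hs), this, sub_self])
  have hioi : EqOn f g (Ioi 0) := by
    refine Measure.eqOn_open_of_ae_eq (μ := volume) ?_ isOpen_Ioi
      (hf.mono Ioi_subset_Ici_self) (hg.mono Ioi_subset_Ici_self)
    rw [EventuallyEq, ae_restrict_iff' measurableSet_Ioi]
    filter_upwards [hae] with x hx h0
    exact sub_eq_zero.1 (hx h0)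
  have := hioi.of_subset_closure hf hg Ioi_subset_Ici_self
  exact this (by rw [closure_Ioi])

/-! ### The random walk: first step, drift, and the value at zero -/

lemma integral_id_expMeasure {θ : ℝ} (hθ : 0 < θ) : ∫ w, w ∂expMeasure θ = 1 / θ := by
  rw [integral_expMeasure hθ]
  have h := Real.integral_rpow_mul_exp_neg_mul_Ioi (a := 2) two_pos hθ
  have h2 : (2 : ℝ) - 1 = 1 := by norm_num
  simp only [h2, Real.rpow_one, Real.Gamma_two, mul_one, Real.rpow_two] at h
  have : ∀ w : ℝ, θ * Real.exp (-(θ * w)) * w = θ * (w * Real.exp (-(θ * w))) := fun w => by ring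
  simp_rw [this]
  rw [integral_const_mul, h]
  field_simp

lemma integrable_id_expMeasure {θ : ℝ} (hθ : 0 < θ) : Integrable (fun w => w) (expMeasure θ) := by
  -- A non-integrable function would have integral `0` by convention, not `1 / θ`.
  by_contra h
  have := integral_id_expMeasure hθ
  rw [integral_undef h] at this
  exact (one_div_pos.2 hθ).ne this

variable {Ω : Type*} [MeasurableSpace Ω] {P : Measure Ω} [IsProbabilityMeasure P]

/-- The probability that the random walk with steps `A i - W i`, started at zero, never exceeds
`y`. -/
def staysBelow (P : Measure Ω) (A W : ℕ → Ω → ℝ) (y : ℝ) : ℝ :=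
  P.real {ω | ∀ n, ∑ i ∈ Finset.range n, (A i ω - W i ω) ≤ y}

lemma staysBelow_monotone (A W : ℕ → Ω → ℝ) : Monotone (staysBelow P A W) := fun _ _ hxy =>
  measureReal_mono fun _ hω n => (hω n).trans hxy

omit [IsProbabilityMeasure P] in
-- The empty sum `n = 0` is one of the constraints.
lemma staysBelow_of_neg (A W : ℕ → Ω → ℝ) {y : ℝ} (hy : y < 0) : staysBelow P A W y = 0 := by
  have : {ω | ∀ n, ∑ i ∈ Finset.range n, (A i ω - W i ω) ≤ y} = ∅ := by
    ext ω
    simp only [mem_ofPred_eq, mem_empty_iff_false, iff_false, not_forall, not_le]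
    exact ⟨0, by simpa using hy⟩
  rw [staysBelow, this, measureReal_empty]

omit [IsProbabilityMeasure P] in
lemma staysBelow_of_nonneg (A W : ℕ → Ω → ℝ) {y : ℝ} (hy : 0 ≤ y) :
    staysBelow P A W y = P.real {ω | ∀ n, ∑ i ∈ Finset.range (n + 1), (A i ω - W i ω) ≤ y} := by
  unfold staysBelow
  congr 1
  ext ω
  refine ⟨fun h n => h _, fun h n => ?_⟩
  cases n with
  | zero => simpa using hy
  | succ n => exact h n

/-- The partial sums of `x (inl i) - x (inr i)`. -/
def pathSum (n : ℕ) (x : ℕ ⊕ ℕ → ℝ) : ℝ :=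
  ∑ i ∈ Finset.range n, (x (Sum.inl i) - x (Sum.inr i))

lemma measurable_pathSum (n : ℕ) : Measurable (pathSum n) := by unfold pathSum; fun_prop

omit [MeasurableSpace Ω] in
lemma comap_pi_le_iSup {ι κ : Type*} (X : ι → Ω → ℝ) (f : κ → ι) :
    MeasurableSpace.comap (fun ω k => X (f k) ω) MeasurableSpace.pi ≤
      ⨆ i ∈ range f, MeasurableSpace.comap (X i) inferInstance := by
  simp only [MeasurableSpace.pi, MeasurableSpace.comap_iSup, MeasurableSpace.comap_comp]
  exact iSup_le fun k => le_iSup₂_of_le (f k) (mem_range_self k) le_rfl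

omit [IsProbabilityMeasure P] in
/-- Disjoint subfamilies of an independent family of random variables are independent. -/
lemma indepFun_of_disjoint {ι κ κ' : Type*} {X : ι → Ω → ℝ} (hX : ∀ i, Measurable (X i))
    (h : iIndepFun X P) (f : κ → ι) (g : κ' → ι) (hfg : Disjoint (range f) (range g)) :
    IndepFun (fun ω k => X (f k) ω) (fun ω k => X (g k) ω) P :=
  indep_of_indep_of_le_right
    (indep_of_indep_of_le_left (indep_iSup_of_disjoint (fun i => (hX i).comap_le) h hfg)
      (comap_pi_le_iSup X f)) (comap_pi_le_iSup X g)

section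

variable {A W : ℕ → Ω → ℝ} {μ ν : Measure ℝ}

/-- First step decomposition for a random walk with steps `A i - W i`. -/
lemma measureReal_walk_le_eq_integral [IsProbabilityMeasure μ] [IsProbabilityMeasure ν]
    (hA : ∀ k, Measurable (A k)) (hW : ∀ k, Measurable (W k))
    (hind : iIndepFun (Sum.elim A W) P) (hAlaw : ∀ k, P.map (A k) = μ)
    (hWlaw : ∀ k, P.map (W k) = ν) (z : ℝ) :
    P.real {ω | ∀ n, ∑ i ∈ Finset.range (n + 1), (A i ω - W i ω) ≤ z} =
      ∫ a, ∫ w, staysBelow P A W (z - a + w) ∂ν ∂μ := by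
  have hX : ∀ i, Measurable (Sum.elim A W i) := by rintro (i | i) <;> simp [hA, hW]
  have hinj : Function.Injective (Sum.map Nat.succ Nat.succ) :=
    Nat.succ_injective.sumMap Nat.succ_injective
  set Q := P.map fun ω i => Sum.elim A W i ω with hQ
  have hmX : Measurable fun ω i => Sum.elim A W i ω := measurable_pi_lambda _ hX
  have hmX' : Measurable fun ω i => Sum.elim A W (Sum.map Nat.succ Nat.succ i) ω :=
    measurable_pi_lambda _ fun i => hX _
  -- Dropping the first step leaves the law of the path unchanged: both laws are the same product
  -- measure.
  have hQ' : P.map (fun ω i => Sum.elim A W (Sum.map Nat.succ Nat.succ i) ω) = Q := by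
    rw [hQ, hind.map_fun_eq_infinitePi_map hX,
      (hind.precomp hinj).map_fun_eq_infinitePi_map fun i => hX _]
    congr 1
    ext1 i
    rcases i with i | i <;> simp [hAlaw, hWlaw]
  have : IsProbabilityMeasure Q := Measure.isProbabilityMeasure_map hmX.aemeasurable
  have hfirst : IndepFun (fun ω => (A 0 ω, W 0 ω))
      (fun ω i => Sum.elim A W (Sum.map Nat.succ Nat.succ i) ω) P := by
    have h := indepFun_of_disjoint hX hind (fun b : Bool => if b then Sum.inl 0 else Sum.inr 0)
      (Sum.map Nat.succ Nat.succ) (by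
        rw [disjoint_left]
        rintro _ ⟨b, rfl⟩ ⟨i, hi⟩
        rcases b <;> rcases i with i | i <;> simp at hi)
    exact h.comp (φ := fun x : Bool → ℝ => (x true, x false)) (by fun_prop) measurable_id
  have hAW : P.map (fun ω => (A 0 ω, W 0 ω)) = μ.prod ν := by
    have h : IndepFun (A 0) (W 0) P :=
      hind.indepFun (i := Sum.inl 0) (j := Sum.inr 0) (by simp)
    rw [(indepFun_iff_map_prod_eq_prod_map_map (hA 0).aemeasurable (hW 0).aemeasurable).1 h,
      hAlaw, hWlaw]
  set B : Set ((ℝ × ℝ) × (ℕ ⊕ ℕ → ℝ)) := {q | ∀ n, pathSum n q.2 ≤ z - q.1.1 + q.1.2} with hB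
  have hBm : MeasurableSet B := by
    have := measurable_pathSum
    simp only [hB, ofPred_forall]
    exact MeasurableSet.iInter fun n => measurableSet_le (by fun_prop) (by fun_prop)
  have hmpair : Measurable fun ω => (A 0 ω, W 0 ω) := (hA 0).prodMk (hW 0)
  have hjoint := (indepFun_iff_map_prod_eq_prod_map_map hmpair.aemeasurable
    hmX'.aemeasurable).1 hfirst
  rw [hAW, hQ'] at hjoint
  -- Splitting off the first step leaves `n` further steps; the case `n = 0` is the empty-sum
  -- constraint of `staysBelow`.
  have hev : {ω | ∀ n, ∑ i ∈ Finset.range (n + 1), (A i ω - W i ω) ≤ z} =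
      (fun ω => ((A 0 ω, W 0 ω), fun i => Sum.elim A W (Sum.map Nat.succ Nat.succ i) ω)) ⁻¹' B := by
    ext ω
    refine forall_congr' fun n => ?_
    simp only [Finset.sum_range_succ', pathSum, Sum.map_inl, Sum.map_inr, Sum.elim_inl,
      Sum.elim_inr]
    constructor <;> intro h <;> linarith
  rw [hev, ← map_measureReal_apply (hmpair.prodMk hmX') hBm, hjoint]
  have hsec : ∀ p : ℝ × ℝ, Q.real (Prod.mk p ⁻¹' B) = staysBelow P A W (z - p.1 + p.2) := by
    intro p
    rw [hQ, map_measureReal_apply hmX (measurable_prodMk_left hBm)]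
    rfl
  have hint : Integrable (fun p : ℝ × ℝ => staysBelow P A W (z - p.1 + p.2)) (μ.prod ν) :=
    integrable_of_measurable_of_mem_Icc
      ((staysBelow_monotone A W).measurable.comp (by fun_prop))
      (fun _ => measureReal_nonneg) (fun _ => measureReal_le_one)
  rw [measureReal_def, Measure.prod_apply hBm, ← integral_prod _ hint, ← integral_toReal]
  · exact integral_congr_ae (Eventually.of_forall hsec)
  · exact (measurable_measure_prodMk_left hBm).aemeasurable
  · exact Eventually.of_forall fun p => measure_lt_top _ _

variable {θ : ℝ}

/-- The drift is negative, so by the strong law the partial sums are eventually nonpositive, hence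
almost surely bounded above. The events for increasing `y` therefore exhaust a set of probability
one. -/
lemma tendsto_staysBelow [IsProbabilityMeasure μ] (hθ : 0 < θ)
    (hA : ∀ k, Measurable (A k)) (hW : ∀ k, Measurable (W k))
    (hind : iIndepFun (Sum.elim A W) P) (hAlaw : ∀ k, P.map (A k) = μ)
    (hWlaw : ∀ k, P.map (W k) = expMeasure θ) (hint : Integrable (fun a => a) μ)
    (hdrift : θ * ∫ a, a ∂μ < 1) : Tendsto (staysBelow P A W) atTop (𝓝 1) := by
  have hX : ∀ i, Measurable (Sum.elim A W i) := by rintro (i | i) <;> simp [hA, hW]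
  have hAint : Integrable (A 0) P := by
    have := hAlaw 0 ▸ hint
    exact (integrable_map_measure (by fun_prop) (hA 0).aemeasurable).1 this
  have hWint : Integrable (W 0) P := by
    have := hWlaw 0 ▸ integrable_id_expMeasure hθ
    exact (integrable_map_measure (by fun_prop) (hW 0).aemeasurable).1 this
  have hAmean : ∫ ω, A 0 ω ∂P = ∫ a, a ∂μ := by
    rw [← hAlaw 0, integral_map (hA 0).aemeasurable (by fun_prop)]
  have hWmean : ∫ ω, W 0 ω ∂P = 1 / θ := by
    rw [← integral_id_expMeasure hθ, ← hWlaw 0, integral_map (hW 0).aemeasurable (by fun_prop)]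
  have hpair : Pairwise fun i j => IndepFun (fun ω => A i ω - W i ω) (fun ω => A j ω - W j ω) P := by
    intro i j hij
    have := hind.indepFun_prodMk_prodMk hX (Sum.inl i) (Sum.inr i) (Sum.inl j) (Sum.inr j)
      (by simpa using hij) (by simp) (by simp) (by simpa using hij)
    exact this.comp (φ := fun p : ℝ × ℝ => p.1 - p.2) (ψ := fun p : ℝ × ℝ => p.1 - p.2)
      (by fun_prop) (by fun_prop)
  have hid : ∀ i, IdentDistrib (fun ω => A i ω - W i ω) (fun ω => A 0 ω - W 0 ω) P P := by
    intro i
    have h : ∀ i, IndepFun (A i) (W i) P := fun i =>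
      hind.indepFun (i := Sum.inl i) (j := Sum.inr i) (by simp)
    have hp : IdentDistrib (fun ω => (A i ω, W i ω)) (fun ω => (A 0 ω, W 0 ω)) P P := by
      refine ⟨((hA i).prodMk (hW i)).aemeasurable, ((hA 0).prodMk (hW 0)).aemeasurable, ?_⟩
      rw [(indepFun_iff_map_prod_eq_prod_map_map (hA i).aemeasurable (hW i).aemeasurable).1 (h i),
        (indepFun_iff_map_prod_eq_prod_map_map (hA 0).aemeasurable (hW 0).aemeasurable).1 (h 0),
        hAlaw, hAlaw, hWlaw, hWlaw]
    exact hp.comp (u := fun p : ℝ × ℝ => p.1 - p.2) (by fun_prop)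
  have hslln := strong_law_ae_real (fun i ω => A i ω - W i ω) (hAint.sub hWint) hpair hid
  have hneg : ∫ ω, (A 0 ω - W 0 ω) ∂P < 0 := by
    rw [integral_sub hAint hWint, hAmean, hWmean, sub_neg, lt_div_iff₀ hθ, mul_comm]
    exact hdrift
  have hae : ∀ᵐ ω ∂P, ω ∈ ⋃ y : ℝ, {ω | ∀ n, ∑ i ∈ Finset.range n, (A i ω - W i ω) ≤ y} := by
    filter_upwards [hslln] with ω hω
    have hev : ∀ᶠ n : ℕ in atTop, ∑ i ∈ Finset.range n, (A i ω - W i ω) ≤ 0 := by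
      filter_upwards [hω.eventually (gt_mem_nhds hneg), eventually_gt_atTop 0] with n hn hn0
      by_contra! hc
      exact absurd hn (not_lt.2 (div_nonneg hc.le (Nat.cast_nonneg n)))
    obtain ⟨y, hy⟩ := (isBoundedUnder_of_eventually_le hev).bddAbove_range
    exact mem_iUnion.2 ⟨y, fun n => hy (mem_range_self n)⟩
  have hmono : Monotone fun y : ℝ => {ω | ∀ n, ∑ i ∈ Finset.range n, (A i ω - W i ω) ≤ y} :=
    fun _ _ hxy _ hω n => (hω n).trans hxy
  have hlim := tendsto_measure_iUnion_atTop (μ := P) hmono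
  have hone : P (⋃ y : ℝ, {ω | ∀ n, ∑ i ∈ Finset.range n, (A i ω - W i ω) ≤ y}) = 1 :=
    (measure_congr (eventuallyEq_univ.2 hae)).trans measure_univ
  rw [hone] at hlim
  exact (ENNReal.tendsto_toReal ENNReal.one_ne_top).comp hlim

lemma staysBelow_zero [IsProbabilityMeasure μ] (hθ : 0 < θ)
    (hA : ∀ k, Measurable (A k)) (hW : ∀ k, Measurable (W k))
    (hind : iIndepFun (Sum.elim A W) P) (hAlaw : ∀ k, P.map (A k) = μ)
    (hWlaw : ∀ k, P.map (W k) = expMeasure θ) (hint : Integrable (fun a => a) μ)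
    (hμ : ∀ᵐ a ∂μ, 0 ≤ a) (hsafe : θ * ∫ a, a ∂μ ≤ 1)
    (hren : ∀ z, 0 ≤ z → staysBelow P A W z = staysBelow P A W 0 +
      θ * ∫ x in (0 : ℝ)..z, staysBelow P A W (z - x) * (1 - μ.real (Iic x))) :
    staysBelow P A W 0 = 1 - θ * ∫ a, a ∂μ := by
  have hm := staysBelow_monotone (P := P) A W
  -- In the critical case the limit need not be known: the factor `1 - θ * ∫ a, a ∂μ` is zero, and
  -- monotonicity supplies some limit.
  obtain ⟨p, hp, hp1⟩ : ∃ p, Tendsto (staysBelow P A W) atTop (𝓝 p) ∧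
      p * (1 - θ * ∫ a, a ∂μ) = 1 - θ * ∫ a, a ∂μ := by
    rcases hsafe.lt_or_eq with h | h
    · exact ⟨1, tendsto_staysBelow hθ hA hW hind hAlaw hWlaw hint h, one_mul _⟩
    · refine ⟨_, tendsto_atTop_ciSup hm ⟨1, ?_⟩, by rw [h]; simp⟩
      rintro _ ⟨y, rfl⟩
      exact measureReal_le_one
  have h1 := ((tendsto_integral_mul_tail hm (fun _ => measureReal_nonneg)
    (fun _ => measureReal_le_one) (fun _ => staysBelow_of_neg A W) hμ hint hp).const_mul θ).const_add
      (staysBelow P A W 0)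
  have h2 := tendsto_nhds_unique (hp.congr' ?_) h1
  · linear_combination hp1 - h2
  · filter_upwards [eventually_ge_atTop 0] with z hz using hren z hz

end

/-! ### Pathwise reduction of ruin to the random walk -/

section Path

variable {Ω : Type*}

lemma claimTime_strictMono {T : ℕ → Ω → ℝ} {ω : Ω} (hT : ∀ k, 0 < T k ω) :
    StrictMono fun n => claimTime T n ω :=
  strictMono_nat_of_lt_succ fun n => by
    simp only [claimTime, Finset.sum_range_succ]
    linarith [hT n]

/-- The strict inequality in `claimCount` excludes the claim at the present time. Hence every count
is attained, which lets continuous time be replaced by the claim index. -/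
lemma claimCount_claimTime_succ {T : ℕ → Ω → ℝ} {ω : Ω} (hT : ∀ k, 0 < T k ω) (n : ℕ) :
    claimCount T (claimTime T (n + 1) ω) ω = n := by
  have hset : {m : ℕ | 1 ≤ m ∧ claimTime T m ω < claimTime T (n + 1) ω} = Icc 1 n := by
    ext m
    have := (claimTime_strictMono hT).lt_iff_lt (a := m) (b := n + 1)
    simp only [mem_ofPred_eq, this, mem_Icc, Nat.lt_succ_iff]
  rw [claimCount, hset]
  rcases Nat.eq_zero_or_pos n with rfl | hn
  -- The set is empty here, and `sSup ∅ = 0` in `ℕ`.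
  · simp
  · exact csSup_Icc hn

variable {α : ℝ}

lemma stableWalk_nonneg {W : ℕ → Ω → ℝ} {ω : Ω} (hW : ∀ k, 0 ≤ W k ω) (n : ℕ) :
    0 ≤ stableWalk α W n ω := by
  induction n with
  | zero => simp [stableWalk]
  | succ n ih =>
    exact Real.rpow_nonneg (add_nonneg (Real.rpow_nonneg ih _) (Real.rpow_nonneg (hW n) _)) _

lemma stableWalk_rpow (hα : 0 < α) {W : ℕ → Ω → ℝ} {ω : Ω} (hW : ∀ k, 0 ≤ W k ω) (n : ℕ) :
    stableWalk α W n ω ^ α = ∑ i ∈ Finset.range n, W i ω ^ α := by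
  induction n with
  | zero => simp [stableWalk, Real.zero_rpow hα.ne']
  | succ n ih =>
    rw [Finset.sum_range_succ, ← ih, stableWalk, stableAdd, one_div, Real.rpow_inv_rpow _ hα.ne']
    exact add_nonneg (Real.rpow_nonneg (stableWalk_nonneg hW n) _) (Real.rpow_nonneg (hW n) _)

open Classical in
lemma tsum_ite_eq_succ {f : ℕ → ℝ} (h0 : f 0 = 0) (N : ℕ) :
    ∑' n : ℕ, (if N = n + 1 then f (n + 1) else 0) = f N := by
  cases N with
  | zero => simp [h0]
  | succ k =>
    rw [tsum_eq_single k (fun n hn => if_neg (by omega)), if_pos rfl]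

lemma riskProcess_eq (hα : 0 < α) {β u t : ℝ} {U V T : ℕ → Ω → ℝ} {ω : Ω}
    (hU : ∀ k, 0 ≤ U k ω) (hV : ∀ k, 0 ≤ V k ω) :
    riskProcess α β u U V T t ω =
      (u ^ α + β ^ α * ∑ i ∈ Finset.range (claimCount T t ω), V i ω ^ α) ^ (1 / α) -
        (∑ i ∈ Finset.range (claimCount T t ω), U i ω ^ α) ^ (1 / α) := by
  have h : ∀ W : ℕ → Ω → ℝ, stableWalk α W 0 ω ^ α = 0 := fun W => by
    simp [stableWalk, Real.zero_rpow hα.ne']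
  rw [riskProcess, tsum_ite_eq_succ (f := fun n => stableWalk α V n ω ^ α) (h V),
    tsum_ite_eq_succ (f := fun n => stableWalk α U n ω ^ α) (h U), stableWalk_rpow hα hU,
    stableWalk_rpow hα hV]

lemma mem_ruinEvent_iff (hα : 0 < α) {β u : ℝ} (hβ : 0 < β) (hu : 0 < u) {U V T : ℕ → Ω → ℝ}
    {ω : Ω} (hU : ∀ k, 0 ≤ U k ω) (hV : ∀ k, 0 ≤ V k ω) (hT : ∀ k, 0 < T k ω) :
    ω ∈ ruinEvent α β u U V T ↔
      ∃ n, u ^ α ≤ ∑ i ∈ Finset.range (n + 1), (U i ω ^ α - β ^ α * V i ω ^ α) := by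
  have huα : 0 < u ^ α := Real.rpow_pos_of_pos hu α
  have hrisk : ∀ t, riskProcess α β u U V T t ω ≤ 0 ↔ u ^ α ≤
      ∑ i ∈ Finset.range (claimCount T t ω), (U i ω ^ α - β ^ α * V i ω ^ α) := by
    intro t
    have h1 : 0 ≤ ∑ i ∈ Finset.range (claimCount T t ω), U i ω ^ α :=
      Finset.sum_nonneg fun i _ => Real.rpow_nonneg (hU i) _
    have h2 : 0 ≤ u ^ α + β ^ α * ∑ i ∈ Finset.range (claimCount T t ω), V i ω ^ α :=
      add_nonneg huα.le (mul_nonneg (Real.rpow_nonneg hβ.le _)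
        (Finset.sum_nonneg fun i _ => Real.rpow_nonneg (hV i) _))
    rw [riskProcess_eq hα hU hV, sub_nonpos, Real.rpow_le_rpow_iff h2 h1 (one_div_pos.2 hα),
      Finset.sum_sub_distrib, ← Finset.mul_sum, le_sub_iff_add_le]
  simp only [ruinEvent, mem_ofPred_eq, hrisk]
  constructor
  · rintro ⟨t, -, h⟩
    cases hN : claimCount T t ω with
    | zero =>
      rw [hN] at h
      exact absurd huα (not_lt.2 (by simpa using h))
    | succ n => exact ⟨n, hN ▸ h⟩
  · rintro ⟨n, h⟩
    -- The count at time `S_{n+2}` is `n + 1`, the number of steps in the sum.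
    refine ⟨claimTime T (n + 2) ω, ?_, by rwa [claimCount_claimTime_succ hT]⟩
    have := claimTime_strictMono hT (Nat.succ_pos (n + 1))
    simpa [claimTime] using this

end Path

variable {Ω : Type*} [MeasurableSpace Ω] {P : Measure Ω} [IsProbabilityMeasure P]

/-! ### Laws of premiums and waiting times; strict against weak inequalities -/

section Premium

variable {α β γ : ℝ}

/-- The distribution function is prescribed only for `x > 0`; by monotonicity its value at `0` is at
most the limit `0` from the right. -/
lemma ae_pos_of_cdf (hα : 0 < α) {V : Ω → ℝ} (hV : Measurable V)
    (hcdf : ∀ x : ℝ, 0 < x → cdf (P.map V) x = 1 - Real.exp (-(γ * x ^ α))) :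
    ∀ᵐ ω ∂P, 0 < V ω := by
  have := Measure.isProbabilityMeasure_map (μ := P) hV.aemeasurable
  have hlim : Tendsto (fun x : ℝ => 1 - Real.exp (-(γ * x ^ α))) (𝓝[>] 0) (𝓝 0) := by
    have hc : Continuous fun x : ℝ => 1 - Real.exp (-(γ * x ^ α)) := by
      have := Real.continuous_rpow_const hα.le
      fun_prop
    have := hc.tendsto 0
    simp only [Real.zero_rpow hα.ne', mul_zero, neg_zero, Real.exp_zero, sub_self] at this
    exact this.mono_left nhdsWithin_le_nhds
  have h0 : cdf (P.map V) 0 ≤ 0 := by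
    refine ge_of_tendsto hlim ?_
    filter_upwards [self_mem_nhdsWithin] with x hx
    rw [← hcdf x hx]
    exact monotone_cdf _ (le_of_lt hx)
  rw [cdf_eq_real] at h0
  have h1 : P.map V (Iic 0) = 0 := (measureReal_eq_zero_iff).1 (le_antisymm h0 measureReal_nonneg)
  rw [Measure.map_apply hV measurableSet_Iic] at h1
  filter_upwards [compl_mem_ae_iff.2 h1] with ω hω
  exact not_le.1 hω

lemma map_premium (hα : 0 < α) (hβ : 0 < β) (hγ : 0 < γ) {V : Ω → ℝ} (hV : Measurable V)
    (hcdf : ∀ x : ℝ, 0 < x → cdf (P.map V) x = 1 - Real.exp (-(γ * x ^ α))) :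
    P.map (fun ω => β ^ α * V ω ^ α) = expMeasure (γ / β ^ α) := by
  have hβα : 0 < β ^ α := Real.rpow_pos_of_pos hβ α
  have hθ : 0 < γ / β ^ α := div_pos hγ hβα
  have hm : Measurable fun ω => β ^ α * V ω ^ α := by fun_prop
  have := Measure.isProbabilityMeasure_map (μ := P) hm.aemeasurable
  have := Measure.isProbabilityMeasure_map (μ := P) hV.aemeasurable
  have := isProbabilityMeasure_expMeasure hθ
  have hpos := ae_pos_of_cdf hα hV hcdf
  refine Measure.eq_of_cdf _ _ ?_
  ext x
  rw [cdf_expMeasure_eq hθ, cdf_eq_real, map_measureReal_apply hm measurableSet_Iic]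
  rcases le_or_gt x 0 with hx | hx
  · have h0 : P.real ((fun ω => β ^ α * V ω ^ α) ⁻¹' Iic x) = 0 := by
      rw [measureReal_eq_zero_iff]
      refine measure_mono_null (t := {ω | ¬ 0 < V ω}) (fun ω hω h => ?_) hpos
      exact absurd (mul_pos hβα (Real.rpow_pos_of_pos h α)) (not_lt.2 (le_trans hω hx))
    rw [h0]
    rcases hx.lt_or_eq with h | rfl
    · rw [if_neg (not_le.2 h)]
    · simp
  · rw [if_pos hx.le]
    have hy : 0 < (x / β ^ α) ^ (1 / α) := Real.rpow_pos_of_pos (div_pos hx hβα) _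
    have h := hcdf _ hy
    rw [cdf_eq_real, map_measureReal_apply hV measurableSet_Iic, one_div,
      Real.rpow_inv_rpow (div_pos hx hβα).le hα.ne'] at h
    have hev : (fun ω => β ^ α * V ω ^ α) ⁻¹' Iic x =ᵐ[P] V ⁻¹' Iic ((x / β ^ α) ^ α⁻¹) := by
      filter_upwards [hpos] with ω hω
      refine propext ?_
      change β ^ α * V ω ^ α ≤ x ↔ V ω ≤ (x / β ^ α) ^ α⁻¹
      rw [Real.le_rpow_inv_iff_of_pos hω.le (div_pos hx hβα).le hα, le_div_iff₀' hβα]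
    rw [measureReal_congr hev, h]
    congr 3
    ring

end Premium

omit [IsProbabilityMeasure P] in
lemma ae_pos_of_map_eq_expMeasure {lam : ℝ} {T : Ω → ℝ} (hlam : 0 < lam) (hT : Measurable T)
    (h : P.map T = expMeasure lam) : ∀ᵐ ω ∂P, 0 < T ω := by
  have h0 : expMeasure lam (Iic 0) = 0 := by
    have := isProbabilityMeasure_expMeasure hlam
    rw [← measureReal_eq_zero_iff, ← cdf_eq_real, cdf_expMeasure_eq hlam]
    simp
  rw [← h, Measure.map_apply hT measurableSet_Iic] at h0
  filter_upwards [compl_mem_ae_iff.2 h0] with ω hω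
  exact not_le.1 hω

/-- If the probability that a random walk stays below `z` depends continuously on `z`, then it
does not matter whether it is expressed by strict or weak inequalities or by the supremum. -/
lemma measureReal_iSup_lt_eq {S : ℕ → Ω → ℝ} (hc : Continuous fun z => P.real {ω | ∀ n, S n ω ≤ z})
    (z : ℝ) :
    P.real {ω | (⨆ n, (S n ω : EReal)) < z} = P.real {ω | ∀ n, S n ω ≤ z} ∧
      P.real {ω | ∀ n, S n ω < z} = P.real {ω | ∀ n, S n ω ≤ z} := by
  have h1 : P.real {ω | (⨆ n, (S n ω : EReal)) < z} ≤ P.real {ω | ∀ n, S n ω < z} :=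
    measureReal_mono fun ω hω n =>
      EReal.coe_lt_coe_iff.1 (lt_of_le_of_lt (le_iSup (fun n => (S n ω : EReal)) n) hω)
  have h2 : P.real {ω | ∀ n, S n ω < z} ≤ P.real {ω | ∀ n, S n ω ≤ z} :=
    measureReal_mono fun ω hω n => (hω n).le
  have h3 : P.real {ω | ∀ n, S n ω ≤ z} ≤ P.real {ω | (⨆ n, (S n ω : EReal)) < z} := by
    -- For `y < z`, staying weakly below `y` forces the supremum strictly below `z`; then `y` tends
    -- to `z` from the left.
    refine le_of_tendsto ((hc.tendsto z).mono_left (nhdsWithin_le_nhds (s := Iio z))) ?_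
    filter_upwards [self_mem_nhdsWithin] with y hy
    exact measureReal_mono fun ω hω =>
      lt_of_le_of_lt (iSup_le fun n => EReal.coe_le_coe_iff.2 (hω n)) (EReal.coe_lt_coe_iff.2 hy)
  exact ⟨le_antisymm (h1.trans h2) h3, le_antisymm h2 (h3.trans h1)⟩

end StableRisk

end

open MeasureTheory ProbabilityTheory Filter Topology Set StableRisk

/-! ### Assembly of the theorem -/

theorem mainTheorem2 {Ω : Type*} [MeasurableSpace Ω]
    (P : MeasureTheory.Measure Ω) [MeasureTheory.IsProbabilityMeasure P]
    (α β γ lam : ℝ) (hα : 0 < α) (hβ : 0 < β) (hγ : 0 < γ) (hlam : 0 < lam)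
    (U V T : ℕ → Ω → ℝ)
    (hU : ∀ k, Measurable (U k)) (hV : ∀ k, Measurable (V k)) (hT : ∀ k, Measurable (T k))
    -- all claims, premiums and waiting times are mutually independent
    (hindep : ProbabilityTheory.iIndepFun
      (Sum.elim U (Sum.elim V T) : ℕ ⊕ ℕ ⊕ ℕ → Ω → ℝ) P)
    -- the claims are nonnegative, identically distributed, with finite moment of order `α`
    (hUid : ∀ k, ProbabilityTheory.IdentDistrib (U k) (U 0) P P)
    (hUnonneg : ∀ k, ∀ᵐ ω ∂P, 0 ≤ U k ω)
    (hUint : MeasureTheory.Integrable (fun ω => U 0 ω ^ α) P)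
    -- the premiums have distribution function `1 - exp (-γ x ^ α)`
    (hVcdf : ∀ k, ∀ x : ℝ, 0 < x →
      ProbabilityTheory.cdf (P.map (V k)) x = 1 - Real.exp (-(γ * x ^ α)))
    -- the waiting times between claims are exponential with mean `1 / lam`
    (hTlaw : ∀ k, P.map (T k) = ProbabilityTheory.expMeasure lam)
    (m : ℝ) (hm : m = ∫ ω, U 0 ω ^ α ∂P)
    -- safety condition
    (hsafe : γ * m ≤ β ^ α)
    (F δ : ℝ → ℝ) (hF : F = StableRisk.claimCDF P α (U 0))
    (hδ : δ = StableRisk.survival P α β U V) :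
    -- the ruin probability in terms of `δ`
    (∀ u : ℝ, 0 < u →
      MeasureTheory.NullMeasurableSet (StableRisk.ruinEvent α β u U V T) P ∧
      StableRisk.ruinProb P α β u U V T = 1 - δ (u ^ α)) ∧
    -- `m` is the integral of the tail `1 - F`
    (MeasureTheory.IntegrableOn (fun x => 1 - F x) (Set.Ioi 0) ∧
      ∫ x in Set.Ioi (0 : ℝ), (1 - F x) = m) ∧
    -- the renewal equation
    (∀ z : ℝ, 0 ≤ z →
      IntervalIntegrable (fun x => δ (z - x) * (1 - F x)) MeasureTheory.volume 0 z ∧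
      δ z = 1 - γ / β ^ α * m + γ / β ^ α * ∫ x in (0 : ℝ)..z, δ (z - x) * (1 - F x)) ∧
    -- the Laplace transform of `δ`
    (∀ s : ℝ, 0 < s →
      StableRisk.LaplaceConverges δ s ∧
      StableRisk.LaplaceConverges (fun x => 1 - F x) s ∧
      0 < β ^ α - γ * StableRisk.laplace (fun x => 1 - F x) s ∧
      StableRisk.laplace δ s =
        (β ^ α - γ * m) / ((β ^ α - γ * StableRisk.laplace (fun x => 1 - F x) s) * s)) ∧
    -- `δ` is determined by its Laplace transform among the continuous functions on `[0, ∞)`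
    (ContinuousOn δ (Set.Ici 0) ∧
      ∀ g : ℝ → ℝ, ContinuousOn g (Set.Ici 0) →
        (∀ s : ℝ, 0 < s → StableRisk.LaplaceConverges g s ∧
          StableRisk.laplace g s =
            (β ^ α - γ * m) / ((β ^ α - γ * StableRisk.laplace (fun x => 1 - F x) s) * s)) →
        ∀ z : ℝ, 0 ≤ z → g z = δ z) := by
  have hβα : 0 < β ^ α := Real.rpow_pos_of_pos hβ α
  set A : ℕ → Ω → ℝ := fun k ω => U k ω ^ α with hAdef
  set W : ℕ → Ω → ℝ := fun k ω => β ^ α * V k ω ^ α with hWdef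
  set θ := γ / β ^ α with hθdef
  set μ := P.map (A 0) with hμdef
  have hθ : 0 < θ := div_pos hγ hβα
  have hA : ∀ k, Measurable (A k) := fun k => by simp only [hAdef]; fun_prop
  have hW : ∀ k, Measurable (W k) := fun k => by simp only [hWdef]; fun_prop
  have : IsProbabilityMeasure μ := Measure.isProbabilityMeasure_map (hA 0).aemeasurable
  have hAlaw : ∀ k, P.map (A k) = μ := fun k =>
    ((hUid k).comp (u := fun x : ℝ => x ^ α) (by fun_prop)).map_eq
  have hWlaw : ∀ k, P.map (W k) = expMeasure θ := fun k => map_premium hα hβ hγ (hV k) (hVcdf k)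
  have hind : iIndepFun (Sum.elim A W) P := by
    have h1 := hindep.precomp (g := (Sum.elim Sum.inl (Sum.inr ∘ Sum.inl) : ℕ ⊕ ℕ → ℕ ⊕ ℕ ⊕ ℕ))
      (by rintro (i | i) (j | j) h <;> simp_all)
    have h2 := h1.comp (Sum.elim (fun _ x => x ^ α) fun _ x => β ^ α * x ^ α)
      (by rintro (i | i) <;> simp only [Sum.elim_inl, Sum.elim_inr] <;> fun_prop)
    convert! h2 using 1
    ext i
    rcases i with i | i <;> rfl
  have hμ : ∀ᵐ a ∂μ, 0 ≤ a := by
    rw [hμdef, ae_map_iff (hA 0).aemeasurable measurableSet_Ici]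
    filter_upwards [hUnonneg 0] with ω hω using Real.rpow_nonneg hω α
  have hint : Integrable (fun a => a) μ :=
    (integrable_map_measure (by fun_prop) (hA 0).aemeasurable).2 hUint
  have hmμ : m = ∫ a, a ∂μ := by
    rw [hm, hμdef, integral_map (hA 0).aemeasurable (by fun_prop)]
  have hsafe' : θ * ∫ a, a ∂μ ≤ 1 := by
    rw [← hmμ, hθdef, div_mul_eq_mul_div, div_le_one hβα]
    exact hsafe
  have hFμ : ∀ x, F x = μ.real (Iic x) := fun x => by
    rw [hF, claimCDF, cdf_eq_real]
  have hmono := staysBelow_monotone (P := P) A W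
  have h0 : ∀ x, 0 ≤ staysBelow P A W x := fun _ => measureReal_nonneg
  have h1 : ∀ x, staysBelow P A W x ≤ 1 := fun _ => measureReal_le_one
  have hneg : ∀ x < 0, staysBelow P A W x = 0 := fun _ => staysBelow_of_neg A W
  have hstep : (fun z => P.real {ω | ∀ n, ∑ i ∈ Finset.range (n + 1), (A i ω - W i ω) ≤ z}) =
      stepMean μ θ (staysBelow P A W) := by
    have := isProbabilityMeasure_expMeasure hθ
    exact funext (measureReal_walk_le_eq_integral hA hW hind hAlaw hWlaw)
  have hcont : Continuous (stepMean μ θ (staysBelow P A W)) := continuous_stepMean hθ hmono h0 h1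
  have hsup := measureReal_iSup_lt_eq (P := P)
    (S := fun n ω => ∑ i ∈ Finset.range (n + 1), (A i ω - W i ω)) (hstep ▸ hcont)
  have hδstep : δ = stepMean μ θ (staysBelow P A W) := by
    rw [hδ, ← hstep]
    exact funext fun z => (hsup z).1
  have hfix : ∀ z, 0 ≤ z → staysBelow P A W z = stepMean μ θ (staysBelow P A W) z :=
    fun z hz => (staysBelow_of_nonneg A W hz).trans (congrFun hstep z)
  -- Restricted to `z ≥ 0`: for negative `z` the empty sum makes `staysBelow` vanish, while `δ` has
  -- no such constraint.
  have hδφ : ∀ z, 0 ≤ z → δ z = staysBelow P A W z := fun z hz => by rw [hδstep, hfix z hz]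
  have hren := fun z hz => renewal_of_eq_stepMean hθ hmono h0 h1 hneg hμ hfix (z := z) hz
  have hzero : staysBelow P A W 0 = 1 - θ * m := by
    rw [hmμ]
    exact staysBelow_zero hθ hA hW hind hAlaw hWlaw hint hμ hsafe' hren
  have hδc : ContinuousOn δ (Ici 0) := hδstep ▸ hcont.continuousOn
  have hlapG : laplace (fun x => 1 - F x) = laplace (fun x => 1 - μ.real (Iic x)) := by
    simp_rw [hFμ]
  have hlapδ : ∀ s, 0 < s → LaplaceConverges δ s ∧
      laplace δ s = (β ^ α - γ * m) / ((β ^ α - γ * laplace (fun x => 1 - F x) s) * s) ∧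
      LaplaceConverges (fun x => 1 - F x) s ∧ 0 < β ^ α - γ * laplace (fun x => 1 - F x) s := by
    intro s hs
    have hlt := mul_laplace_tail_lt hθ hμ hint hsafe' hs
    have hpos : 0 < β ^ α - γ * laplace (fun x => 1 - F x) s := by
      rw [hlapG, sub_pos]
      rwa [hθdef, div_mul_eq_mul_div, div_lt_one hβα] at hlt
    refine ⟨?_, ?_, ?_, hpos⟩
    · refine (laplaceConverges_of_bounded hmono.measurable h0 h1 hs).congr_fun (fun z hz => ?_)
        measurableSet_Ioi
      simp only [hδφ z (le_of_lt hz)]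
    · have hL := laplace_of_renewal hmono h0 h1 hren hs
      have hδL : laplace δ s = laplace (staysBelow P A W) s :=
        setIntegral_congr_fun measurableSet_Ioi fun z hz => by simp only [hδφ z (le_of_lt hz)]
      rw [← hδL, hzero, ← hlapG, hθdef] at hL
      rw [eq_div_iff (mul_pos hpos hs).ne']
      field_simp at hL
      linear_combination hL
    · simp_rw [hFμ]
      exact laplaceConverges_of_bounded (antitone_tail μ).measurable (tail_nonneg μ)
        (fun x => by linarith [measureReal_nonneg (μ := μ) (s := Iic x)]) hs
  refine ⟨fun u hu => ?_, ⟨?_, ?_⟩, fun z hz => ?_, fun s hs => ?_, hδc, fun g hg hgL z hz => ?_⟩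
  · have hbelow : MeasurableSet {ω | ∀ n, ∑ i ∈ Finset.range (n + 1), (A i ω - W i ω) < u ^ α} := by
      simp only [ofPred_forall]
      exact MeasurableSet.iInter fun n => measurableSet_lt
        (Finset.measurable_fun_sum _ fun i _ => (hA i).sub (hW i)) measurable_const
    -- The signs of claims, premiums and waiting times hold only almost surely, so the ruin event is
    -- identified up to a null set.
    have hev : ruinEvent α β u U V T =ᵐ[P]
        ({ω | ∀ n, ∑ i ∈ Finset.range (n + 1), (A i ω - W i ω) < u ^ α}ᶜ : Set Ω) := by
      filter_upwards [ae_all_iff.2 hUnonneg,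
        ae_all_iff.2 fun k => ae_pos_of_cdf hα (hV k) (hVcdf k),
        ae_all_iff.2 fun k => ae_pos_of_map_eq_expMeasure hlam (hT k) (hTlaw k)] with ω h1 h2 h3
      refine propext ((mem_ruinEvent_iff hα hβ hu h1 (fun k => (h2 k).le) h3).trans ?_)
      change _ ↔ ¬ ∀ n, ∑ i ∈ Finset.range (n + 1), (A i ω - W i ω) < u ^ α
      simp only [not_forall, not_lt, hAdef, hWdef]
    refine ⟨hbelow.compl.nullMeasurableSet.congr hev.symm, ?_⟩
    rw [ruinProb, measureReal_congr hev, probReal_compl_eq_one_sub hbelow, (hsup _).2, hδstep,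
      ← hstep]
  · simp_rw [hFμ]
    exact integrableOn_tail hμ hint
  · simp_rw [hFμ]
    rw [hmμ, integral_tail hμ hint]
  · have hcongr : EqOn (fun x => staysBelow P A W (z - x) * (1 - μ.real (Iic x)))
        (fun x => δ (z - x) * (1 - F x)) (uIcc 0 z) := fun x hx => by
      rw [uIcc_of_le hz] at hx
      simp only [hFμ, hδφ (z - x) (sub_nonneg.2 hx.2)]
    refine ⟨(intervalIntegrable_mul_tail hmono h0 z 0 z).congr fun x hx =>
      hcongr (uIoc_subset_uIcc hx), ?_⟩
    rw [hδφ z hz, hren z hz, hzero, intervalIntegral.integral_congr hcongr]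
  · obtain ⟨h1, h2, h3, h4⟩ := hlapδ s hs
    exact ⟨h1, h3, h4, h2⟩
  · exact eqOn_Ici_of_laplace_eq hg hδc (fun s hs => (hgL s hs).1) (fun s hs => (hlapδ s hs).1)
      (fun s hs => (hgL s hs).2.trans (hlapδ s hs).2.1.symm) hz
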